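/- Let $n\ge 1$, let $F=(f_1,\dots,f_n):\mathbb R^n\to\mathbb R^n$ be a $C^\infty$ map whose Jacobian determinant $J(F)$ vanishes nowhere, and let $i\in\{1,\dots,n\}$. Let $F_i=(f_1,\dots,f_{i-1},f_{i+1},\dots,f_n):\mathbb R^n\to\mathbb R^{n-1}$, and for $g\in C^\infty(\mathbb R^n)$ (the real-valued smooth functions on $\mathbb R^n$) let $$\Delta_i^F(g)=J(f_1,\dots,f_{i-1},g,f_{i+1},\dots,f_n).$$ Suppose that $F_i$ is a local fibration on its range, that is, for every $t_0\in F_i(\mathbb R^n)$ there exist a neighborhood $V$ of $t_0$ in $\mathbb R^{n-1}$ and a homeomorphism $h:F_i^{-1}(t_0)\times V\to F_i^{-1}(V)$ such that $F_i(h(p,v))=v$ for all $(p,v)\in F_i^{-1}(t_0)\times V$. Then $$\Delta_i^F\left(C^\infty(\mathbb R^n)\right)=C^\infty(\mathbb R^n).$$ -/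

import Mathlib

open scoped ContDiff Topology

noncomputable section

namespace JacobianOperators

/-- The Jacobian determinant `J(G)` of a mapping `G : ℝⁿ → ℝⁿ`. -/
def jacobianDet {n : ℕ} (G : (Fin n → ℝ) → (Fin n → ℝ)) (x : Fin n → ℝ) : ℝ :=
  (fderiv ℝ G x).det

/-- The mapping `Fᵢ = (f₁, …, fᵢ₋₁, fᵢ₊₁, …, fₙ) : ℝⁿ → ℝⁿ⁻¹` obtained from
`F = (f₁, …, fₙ)` by deleting the `i`-th coordinate function. The coordinates of `ℝⁿ⁻¹`
are indexed by the indices different from `i`. -/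
def dropCoord {n : ℕ} (F : (Fin n → ℝ) → (Fin n → ℝ)) (i : Fin n) :
    (Fin n → ℝ) → ({j : Fin n // j ≠ i} → ℝ) :=
  fun x j => F x j

/-- The operator `Δᵢ^F(g) = J(f₁, …, fᵢ₋₁, g, fᵢ₊₁, …, fₙ)`. -/
def jacobianOperator {n : ℕ} (F : (Fin n → ℝ) → (Fin n → ℝ)) (i : Fin n)
    (g : (Fin n → ℝ) → ℝ) : (Fin n → ℝ) → ℝ :=
  jacobianDet (fun y => Function.update (F y) i (g y))

/-- The set `C^∞(ℝⁿ)` of smooth real functions on `ℝⁿ`. -/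
def smoothFunctions (n : ℕ) : Set ((Fin n → ℝ) → ℝ) :=
  {g | ContDiff ℝ ∞ g}

section Fibration

variable {M N : Type*} [TopologicalSpace M] [TopologicalSpace N]

/-- A (continuous) mapping `f : M → N` is a local fibration at `t₀` if there are a neighborhood
`V` of `t₀` and a homeomorphism `h : f⁻¹(t₀) × V → f⁻¹(V)` with `f ∘ h = π₂`. -/
def IsLocalFibrationAt (f : M → N) (t₀ : N) : Prop :=
  ∃ V ∈ 𝓝 t₀, ∃ h : (f ⁻¹' {t₀}) × V ≃ₜ f ⁻¹' V, ∀ p, f (h p) = p.2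

/-- The bifurcation set `B(f)`: the points of `N` at which `f` is not a local fibration. -/
def bifurcationSet (f : M → N) : Set N :=
  {t | ¬ IsLocalFibrationAt f t}

/-- `f` is a local fibration on its range if `B(f) ∩ f(M) = ∅`. -/
def IsLocalFibrationOnRange (f : M → N) : Prop :=
  bifurcationSet f ∩ Set.range f = ∅

end Fibration

end JacobianOperators

end

noncomputable section

namespace JacobianOperators

open Set Filter MeasureTheory

theorem isOpen_forall_mem_Icc {P : Type*} [TopologicalSpace P] {O : Set (P × ℝ)} (hO : IsOpen O) :
    IsOpen {x : P | ∀ t ∈ Icc (0 : ℝ) 1, (x, t) ∈ O} := by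
  rw [isOpen_iff_mem_nhds]
  intro x hx
  have hsub : ({x} : Set P) ×ˢ Icc (0 : ℝ) 1 ⊆ O := by
    rintro ⟨y, t⟩ ⟨hy, ht⟩
    rw [mem_singleton_iff] at hy
    subst hy
    exact hx t ht
  obtain ⟨u, v, hu, -, hxu, hv, huv⟩ :=
    generalized_tube_lemma isCompact_singleton isCompact_Icc hO hsub
  filter_upwards [hu.mem_nhds (hxu rfl)] with y hy t ht
  exact huv ⟨hy, hv ht⟩

theorem hasFDerivAt_integral_zero_one {P G : Type} [NormedAddCommGroup P] [NormedSpace ℝ P]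
    [FiniteDimensional ℝ P] [NormedAddCommGroup G] [NormedSpace ℝ G]
    {f : P × ℝ → G} {O : Set (P × ℝ)} (hO : IsOpen O) (hf : ContDiffOn ℝ 1 f O) {x : P}
    (hx : ∀ t ∈ Icc (0 : ℝ) 1, (x, t) ∈ O) :
    HasFDerivAt (fun y => ∫ t in (0 : ℝ)..1, f (y, t))
      (∫ t in (0 : ℝ)..1, (fderiv ℝ f (x, t)).comp (ContinuousLinearMap.inl ℝ P ℝ)) x := by
  have hcont : ContinuousOn f O := hf.continuousOn
  have hder : ContinuousOn (fun q => (fderiv ℝ f q).comp (ContinuousLinearMap.inl ℝ P ℝ)) O :=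
    (hf.continuousOn_fderiv_of_isOpen hO le_rfl).clm_comp continuousOn_const
  have hopen := isOpen_forall_mem_Icc hO
  obtain ⟨r, hr, hball⟩ := Metric.nhds_basis_closedBall.mem_iff.1 (hopen.mem_nhds hx)
  have hcompact : IsCompact (Metric.closedBall x r ×ˢ Icc (0 : ℝ) 1) :=
    (isCompact_closedBall x r).prod isCompact_Icc
  have hsub : Metric.closedBall x r ×ˢ Icc (0 : ℝ) 1 ⊆ O := fun q hq => hball hq.1 q.2 hq.2
  obtain ⟨C, hC⟩ := hcompact.exists_bound_of_continuousOn (hder.mono hsub)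
  have hslice : ∀ y ∈ Metric.closedBall x r, MapsTo (fun t : ℝ => (y, t)) (uIcc 0 1) O := by
    intro y hy t ht
    rw [uIcc_of_le zero_le_one] at ht
    exact hball hy t ht
  have hpair : ∀ y : P, ContinuousOn (fun t : ℝ => (y, t)) (uIcc 0 1) := fun y => by fun_prop
  have hint : ∀ y ∈ Metric.closedBall x r,
      IntervalIntegrable (fun t => f (y, t)) volume 0 1 := fun y hy =>
    (hcont.comp (hpair y) (hslice y hy)).intervalIntegrable
  have hxball : x ∈ Metric.closedBall x r := Metric.mem_closedBall_self hr.le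
  refine intervalIntegral.hasFDerivAt_integral_of_dominated_of_fderiv_le (bound := fun _ => C)
    (Metric.closedBall_mem_nhds x hr)
    (F' := fun y t => (fderiv ℝ f (y, t)).comp (ContinuousLinearMap.inl ℝ P ℝ))
    ?_ (hint x hxball) ?_ ?_ intervalIntegrable_const ?_
  · filter_upwards [Metric.closedBall_mem_nhds x hr] with y hy
    exact (uIoc_of_le (zero_le_one' ℝ)).symm ▸ (hint y hy).aestronglyMeasurable
  · exact (uIoc_of_le (zero_le_one' ℝ)).symm ▸
      ((hder.comp (hpair x) (hslice x hxball)).intervalIntegrable).aestronglyMeasurable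
  · refine Eventually.of_forall fun t ht y hy => hC (y, t) ⟨hy, ?_⟩
    rw [uIoc_of_le zero_le_one] at ht
    exact Ioc_subset_Icc_self ht
  · refine Eventually.of_forall fun t ht y hy => ?_
    rw [uIoc_of_le zero_le_one] at ht
    have hm : (y, t) ∈ O := hball hy t (Ioc_subset_Icc_self ht)
    have h1 : HasFDerivAt f (fderiv ℝ f (y, t)) (y, t) :=
      ((hf.contDiffAt (hO.mem_nhds hm)).differentiableAt (by simp)).hasFDerivAt
    exact h1.comp y (hasFDerivAt_prodMk_left y t)

theorem contDiffOn_integral_zero_one_nat {P : Type} [NormedAddCommGroup P] [NormedSpace ℝ P]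
    [FiniteDimensional ℝ P] (n : ℕ) {G : Type} [NormedAddCommGroup G] [NormedSpace ℝ G]
    {f : P × ℝ → G} {O : Set (P × ℝ)} (hO : IsOpen O) (hf : ContDiffOn ℝ ∞ f O) :
    ContDiffOn ℝ n (fun y => ∫ t in (0 : ℝ)..1, f (y, t))
      {x : P | ∀ t ∈ Icc (0 : ℝ) 1, (x, t) ∈ O} := by
  have hopen := isOpen_forall_mem_Icc hO
  have hderiv : ∀ x ∈ {x : P | ∀ t ∈ Icc (0 : ℝ) 1, (x, t) ∈ O}, _ := fun x hx =>
    hasFDerivAt_integral_zero_one hO (hf.of_le (by simp)) hx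
  induction n generalizing G with
  | zero =>
    exact contDiffOn_zero.2 fun x hx => (hderiv x hx).continuousAt.continuousWithinAt
  | succ n ih =>
    push_cast
    rw [contDiffOn_succ_iff_fderiv_of_isOpen hopen]
    refine ⟨fun x hx => (hderiv x hx).differentiableAt.differentiableWithinAt, by simp, ?_⟩
    have hf' : ContDiffOn ℝ ∞
        (fun q => (fderiv ℝ f q).comp (ContinuousLinearMap.inl ℝ P ℝ)) O :=
      (hf.fderiv_of_isOpen hO (by simp)).clm_comp contDiffOn_const
    refine (ih hf' fun x hx => hasFDerivAt_integral_zero_one hO (hf'.of_le (by simp)) hx).congr ?_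
    exact fun x hx => (hderiv x hx).fderiv

/-- An integral over `[0, 1]` depends smoothly on a parameter. -/
theorem contDiffOn_integral_zero_one {P G : Type} [NormedAddCommGroup P] [NormedSpace ℝ P]
    [FiniteDimensional ℝ P] [NormedAddCommGroup G] [NormedSpace ℝ G]
    {f : P × ℝ → G} {O : Set (P × ℝ)} (hO : IsOpen O) (hf : ContDiffOn ℝ ∞ f O) :
    ContDiffOn ℝ ∞ (fun y => ∫ t in (0 : ℝ)..1, f (y, t))
      {x : P | ∀ t ∈ Icc (0 : ℝ) 1, (x, t) ∈ O} :=
  contDiffOn_infty.2 fun n => contDiffOn_integral_zero_one_nat n hO hf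

theorem update_eq_add_single {n : ℕ} (w : Fin n → ℝ) (i : Fin n) (s : ℝ) :
    Function.update w i s = w + (s - w i) • Pi.single i (1 : ℝ) := by
  ext j
  rcases eq_or_ne j i with rfl | h
  · simp
  · simp [h]

/-- A smooth function on an open set with suitable slices has a smooth primitive with respect to
the `i`-th coordinate. -/
theorem exists_coordinate_primitive {n : ℕ} (i : Fin n) {k : (Fin n → ℝ) → ℝ}
    {W W' : Set (Fin n → ℝ)} (hW : IsOpen W) (hW' : IsOpen W') (hk : ContDiffOn ℝ ∞ k W) (s₀ : ℝ)
    (hseg : ∀ w ∈ W', ∀ s ∈ uIcc s₀ (w i), Function.update w i s ∈ W) :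
    ∃ u : (Fin n → ℝ) → ℝ, ContDiffOn ℝ ∞ u W' ∧
      ∀ w ∈ W', fderiv ℝ u w (Pi.single i 1) = k w := by
  let m : (Fin n → ℝ) × ℝ → (Fin n → ℝ) :=
    fun q => q.1 + ((s₀ + q.2 * (q.1 i - s₀)) - q.1 i) • Pi.single i (1 : ℝ)
  have hm : ContDiff ℝ ∞ m := by
    have : ContDiff ℝ ∞ (fun q : (Fin n → ℝ) × ℝ => q.1 i) :=
      (contDiff_apply ℝ ℝ i).comp contDiff_fst
    exact contDiff_fst.add (((contDiff_const.add (contDiff_snd.mul (this.sub contDiff_const))).sub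
      this).smul contDiff_const)
  have hm_eq : ∀ w t, m (w, t) = Function.update w i (s₀ + t * (w i - s₀)) := fun w t =>
    (update_eq_add_single w i _).symm
  have hO : IsOpen (m ⁻¹' W) := hW.preimage hm.continuous
  have hkm : ContDiffOn ℝ ∞ (fun q => k (m q)) (m ⁻¹' W) :=
    hk.comp hm.contDiffOn fun q hq => hq
  have hI := contDiffOn_integral_zero_one hO hkm
  let u : (Fin n → ℝ) → ℝ := fun w => (w i - s₀) * ∫ t in (0 : ℝ)..1, k (m (w, t))
  have hu_eq : ∀ w, u w = ∫ s in s₀..(w i), k (Function.update w i s) := by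
    intro w
    have := intervalIntegral.mul_integral_comp_add_mul (a := 0) (b := 1)
      (f := fun s => k (Function.update w i s)) (w i - s₀) s₀
    simp only [mul_zero, add_zero, mul_one, add_sub_cancel] at this
    rw [← this]
    simp only [u, hm_eq, mul_comm]
  have hsub : W' ⊆ {x | ∀ t ∈ Icc (0 : ℝ) 1, (x, t) ∈ m ⁻¹' W} := by
    intro w hw t ht
    rw [mem_preimage, hm_eq]
    refine hseg w hw _ ?_
    rw [mem_uIcc]
    rcases le_total s₀ (w i) with h | h
    · left
      constructor <;> nlinarith [ht.1, ht.2]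
    · right
      constructor <;> nlinarith [ht.1, ht.2]
  have hu : ContDiffOn ℝ ∞ u W' :=
    ((contDiff_apply ℝ ℝ i).sub contDiff_const).contDiffOn.mul (hI.mono hsub)
  refine ⟨u, hu, fun w hw => ?_⟩
  have hline : HasDerivAt (fun s => Function.update w i s) (Pi.single i (1 : ℝ)) (w i) :=
    hasDerivAt_update w i (w i)
  have hcontU : Continuous fun s => Function.update w i s := by fun_prop
  have hkU : ContinuousOn (fun s => k (Function.update w i s))
      ((fun s => Function.update w i s) ⁻¹' W) :=
    hk.continuousOn.comp hcontU.continuousOn fun s hs => hs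
  have hUopen : IsOpen ((fun s => Function.update w i s) ⁻¹' W) := hW.preimage hcontU
  have hFTC : HasDerivAt (fun t => ∫ s in s₀..t, k (Function.update w i s))
      (k (Function.update w i (w i))) (w i) := by
    have hwmem : w i ∈ (fun s => Function.update w i s) ⁻¹' W := hseg w hw _ right_mem_uIcc
    refine intervalIntegral.integral_hasDerivAt_right ?_ ?_ (hkU.continuousAt
      (hUopen.mem_nhds hwmem))
    · exact (hkU.mono fun s hs => hseg w hw s hs).intervalIntegrable
    · exact hkU.stronglyMeasurableAtFilter hUopen _ hwmem
  have hfd : HasFDerivAt u (fderiv ℝ u w) (Function.update w i (w i)) := by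
    rw [Function.update_eq_self]
    exact ((hu.contDiffAt (hW'.mem_nhds hw)).differentiableAt (by simp)).hasFDerivAt
  have hcomp := hfd.comp_hasDerivAt (w i) hline
  have heq : (u ∘ fun s => Function.update w i s) =
      fun t => ∫ s in s₀..t, k (Function.update w i s) := by
    ext t
    simp [hu_eq]
  rw [heq] at hcomp
  have := hcomp.unique hFTC
  rwa [Function.update_eq_self] at this

/-- The vector field whose associated derivation is `jacobianOperator F i`. -/
def jacobianField {n : ℕ} (F : (Fin n → ℝ) → (Fin n → ℝ)) (i : Fin n) (x : Fin n → ℝ) :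
    Fin n → ℝ :=
  jacobianDet F x • (fderiv ℝ F x).inverse (Pi.single i 1)

theorem fderiv_jacobianField {n : ℕ} {F : (Fin n → ℝ) → (Fin n → ℝ)} {x : Fin n → ℝ}
    (hJ : jacobianDet F x ≠ 0) (i : Fin n) :
    fderiv ℝ F x (jacobianField F i x) = jacobianDet F x • Pi.single i 1 := by
  have hinv : fderiv ℝ F x ((fderiv ℝ F x).inverse (Pi.single i 1)) = Pi.single i 1 := by
    have hL := ContinuousLinearMap.coe_toContinuousLinearEquivOfDetNeZero (fderiv ℝ F x) hJ
    rw [← hL, ContinuousLinearMap.inverse_equiv]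
    simp
  rw [jacobianField, map_smul, hinv]

theorem det_update_coordinate {n : ℕ} (L : (Fin n → ℝ) →L[ℝ] (Fin n → ℝ)) (hL : L.det ≠ 0)
    (l : (Fin n → ℝ) →L[ℝ] ℝ) (i : Fin n) :
    (L + (l - (ContinuousLinearMap.proj i).comp L).smulRight (Pi.single i (1 : ℝ))).det =
      L.det * l (L.inverse (Pi.single i 1)) := by
  obtain ⟨A, rfl⟩ : ∃ A : (Fin n → ℝ) ≃L[ℝ] (Fin n → ℝ), (A : _ →L[ℝ] _) = L :=
    ⟨_, ContinuousLinearMap.coe_toContinuousLinearEquivOfDetNeZero L hL⟩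
  rw [ContinuousLinearMap.inverse_equiv]
  let φ : (Fin n → ℝ) →L[ℝ] ℝ :=
    l.comp (A.symm : (Fin n → ℝ) →L[ℝ] (Fin n → ℝ)) - ContinuousLinearMap.proj i
  have hcomp : ((A : (Fin n → ℝ) →L[ℝ] (Fin n → ℝ)) +
      (l - (ContinuousLinearMap.proj i).comp (A : (Fin n → ℝ) →L[ℝ] (Fin n → ℝ))).smulRight
        (Pi.single i (1 : ℝ)) : (Fin n → ℝ) →L[ℝ] (Fin n → ℝ)).toLinearMap =
      (LinearMap.transvection φ.toLinearMap (Pi.single i (1 : ℝ))).comp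
        (A : (Fin n → ℝ) →L[ℝ] (Fin n → ℝ)).toLinearMap := by
    refine LinearMap.ext fun y => ?_
    simp [LinearMap.transvection.apply, φ]
  rw [ContinuousLinearMap.det, hcomp, LinearMap.det_comp, LinearMap.transvection.det]
  simp [φ, ContinuousLinearMap.det, mul_comm]

theorem jacobianOperator_eq_fderiv {n : ℕ} {F : (Fin n → ℝ) → (Fin n → ℝ)} {x : Fin n → ℝ}
    (hF : DifferentiableAt ℝ F x) (hJ : jacobianDet F x ≠ 0) (i : Fin n)
    {g : (Fin n → ℝ) → ℝ} (hg : DifferentiableAt ℝ g x) :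
    jacobianOperator F i g x = fderiv ℝ g x (jacobianField F i x) := by
  have heq : (fun y => Function.update (F y) i (g y)) =
      fun y => F y + (g y - F y i) • Pi.single i (1 : ℝ) := by
    ext1 y
    exact update_eq_add_single _ _ _
  have hFi : HasFDerivAt (fun y => F y i)
      ((ContinuousLinearMap.proj i).comp (fderiv ℝ F x)) x :=
    (ContinuousLinearMap.proj (R := ℝ) (φ := fun _ : Fin n => ℝ) i).hasFDerivAt.comp x
      hF.hasFDerivAt
  have hd := hF.hasFDerivAt.add ((hg.hasFDerivAt.sub hFi).smul_const (Pi.single i (1 : ℝ)))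
  have hdet := det_update_coordinate (fderiv ℝ F x) hJ (fderiv ℝ g x) i
  rw [jacobianOperator, jacobianDet, heq]
  refine (congrArg ContinuousLinearMap.det hd.fderiv).trans (hdet.trans ?_)
  simp [jacobianField, jacobianDet]

theorem contDiff_jacobianDet {n : ℕ} {G : (Fin n → ℝ) → (Fin n → ℝ)} (hG : ContDiff ℝ ∞ G) :
    ContDiff ℝ ∞ (jacobianDet G) := by
  have heq : jacobianDet G = fun x => ∑ σ : Equiv.Perm (Fin n), Equiv.Perm.sign σ •
      ∏ j, LinearMap.toMatrix' (fderiv ℝ G x).toLinearMap (σ j) j := by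
    ext x
    rw [← Matrix.det_apply, LinearMap.det_toMatrix', jacobianDet, ContinuousLinearMap.det]
  rw [heq]
  refine ContDiff.sum fun σ _ => ContDiff.const_smul _ (contDiff_prod fun j _ => ?_)
  have h1 : ContDiff ℝ ∞ fun x => fderiv ℝ G x (Pi.single j 1) :=
    (hG.fderiv_right (by simp)).clm_apply contDiff_const
  have h2 : ContDiff ℝ ∞ fun x => fderiv ℝ G x (Pi.single j 1) (σ j) := contDiff_pi.1 h1 _
  exact h2

theorem contDiff_update {n : ℕ} {F : (Fin n → ℝ) → (Fin n → ℝ)} (hF : ContDiff ℝ ∞ F)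
    (i : Fin n) {g : (Fin n → ℝ) → ℝ} (hg : ContDiff ℝ ∞ g) :
    ContDiff ℝ ∞ fun y => Function.update (F y) i (g y) := by
  have heq : (fun y => Function.update (F y) i (g y)) =
      fun y => F y + (g y - F y i) • Pi.single i (1 : ℝ) := by
    ext1 y
    exact update_eq_add_single _ _ _
  rw [heq]
  exact hF.add ((hg.sub (contDiff_pi.1 hF i)).smul contDiff_const)

theorem exists_equiv_hasFDerivAt {n : ℕ} {F : (Fin n → ℝ) → (Fin n → ℝ)}
    (hF : ContDiff ℝ ∞ F) {x : Fin n → ℝ} (hJ : jacobianDet F x ≠ 0) :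
    ∃ A : (Fin n → ℝ) ≃L[ℝ] (Fin n → ℝ), HasFDerivAt F (A : (Fin n → ℝ) →L[ℝ] (Fin n → ℝ)) x := by
  have hL := ContinuousLinearMap.coe_toContinuousLinearEquivOfDetNeZero (fderiv ℝ F x) hJ
  have hd := (hF.differentiable (by simp) x).hasFDerivAt
  rw [← hL] at hd
  exact ⟨_, hd⟩

theorem isLocalHomeomorph_of_jacobianDet_ne_zero {n : ℕ} {F : (Fin n → ℝ) → (Fin n → ℝ)}
    (hF : ContDiff ℝ ∞ F) (hJ : ∀ x, jacobianDet F x ≠ 0) : IsLocalHomeomorph F := by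
  refine IsLocalHomeomorph.mk F fun x => ?_
  obtain ⟨A, hd⟩ := exists_equiv_hasFDerivAt hF (hJ x)
  exact ⟨hF.contDiffAt.toOpenPartialHomeomorph F hd (by simp),
    hF.contDiffAt.mem_toOpenPartialHomeomorph_source hd (by simp), fun _ _ => rfl⟩

/-- On an open set where it is injective, a smooth map with invertible derivatives has a smooth
inverse. -/
theorem exists_contDiffOn_leftInvOn {n : ℕ} {F : (Fin n → ℝ) → (Fin n → ℝ)}
    (hF : ContDiff ℝ ∞ F) (hJ : ∀ x, jacobianDet F x ≠ 0) {U : Set (Fin n → ℝ)} (hU : IsOpen U)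
    (hinj : InjOn F U) :
    ∃ G : (Fin n → ℝ) → (Fin n → ℝ), ContDiffOn ℝ ∞ G (F '' U) ∧ LeftInvOn G F U := by
  let e : OpenPartialHomeomorph (Fin n → ℝ) (Fin n → ℝ) :=
    OpenPartialHomeomorph.ofContinuousOpen (hinj.toPartialEquiv F U) hF.continuous.continuousOn
      (isLocalHomeomorph_of_jacobianDet_ne_zero hF hJ).isOpenMap hU
  refine ⟨e.symm, ?_, fun x hx => e.left_inv hx⟩
  rintro _ ⟨x, hx, rfl⟩
  refine ContDiffAt.contDiffWithinAt ?_
  obtain ⟨A, hd⟩ := exists_equiv_hasFDerivAt hF (hJ x)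
  have hx' : e.symm (F x) = x := e.left_inv hx
  refine e.contDiffAt_symm (mem_image_of_mem F hx) (f₀' := A) ?_ ?_
  · rw [hx']
    exact hd
  · exact hF.contDiffAt

/-- The points `x` and `y` lie in the same fibre of `dropCoord F i`, and the segment from `F x` to
`F y` lifts through `F` to a path from `x` to `y`. -/
def SegmentLifts {n : ℕ} (F : (Fin n → ℝ) → (Fin n → ℝ)) (i : Fin n) (x y : Fin n → ℝ) : Prop :=
  dropCoord F i x = dropCoord F i y ∧ ∃ γ : ℝ → (Fin n → ℝ),
    ContinuousOn γ (uIcc (F x i) (F y i)) ∧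
    (∀ s ∈ uIcc (F x i) (F y i), F (γ s) = Function.update (F x) i s) ∧
    γ (F x i) = x ∧ γ (F y i) = y

section

variable {n : ℕ} {F : (Fin n → ℝ) → (Fin n → ℝ)} {i : Fin n} {x y z : Fin n → ℝ}

theorem update_eq_update_of_dropCoord_eq (h : dropCoord F i x = dropCoord F i y) (s : ℝ) :
    Function.update (F x) i s = Function.update (F y) i s := by
  ext j
  by_cases hj : j = i
  · subst hj
    simp
  · rw [Function.update_of_ne hj, Function.update_of_ne hj]
    exact congrFun h ⟨j, hj⟩

theorem dropCoord_eq_of_eq_update {s : ℝ} (h : F y = Function.update (F x) i s) :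
    dropCoord F i y = dropCoord F i x := by
  ext j
  simp [dropCoord, h, j.2]

theorem eq_update_of_dropCoord_eq (h : dropCoord F i x = dropCoord F i y) :
    F y = Function.update (F x) i (F y i) := by
  rw [update_eq_update_of_dropCoord_eq h, Function.update_eq_self]

theorem SegmentLifts.refl (x : Fin n → ℝ) : SegmentLifts F i x x := by
  refine ⟨rfl, fun _ => x, continuousOn_const, fun s hs => ?_, rfl, rfl⟩
  rw [uIcc_self, mem_singleton_iff] at hs
  rw [hs, Function.update_eq_self]

theorem SegmentLifts.symm (h : SegmentLifts F i x y) : SegmentLifts F i y x := by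
  obtain ⟨hxy, γ, hγ, hFγ, hx, hy⟩ := h
  refine ⟨hxy.symm, γ, uIcc_comm (F x i) (F y i) ▸ hγ, fun s hs => ?_, hy, hx⟩
  rw [hFγ s (uIcc_comm (F x i) (F y i) ▸ hs), update_eq_update_of_dropCoord_eq hxy]

theorem SegmentLifts.trans (hF : IsLocalHomeomorph F) (hxy : SegmentLifts F i x y)
    (hyz : SegmentLifts F i y z) : SegmentLifts F i x z := by
  obtain ⟨hfxy, γ₁, hγ₁, hFγ₁, hx₁, hy₁⟩ := hxy
  obtain ⟨hfyz, γ₂, hγ₂, hFγ₂, hy₂, hz₂⟩ := hyz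
  have hagree : EqOn γ₁ γ₂ (uIcc (F x i) (F y i) ∩ uIcc (F y i) (F z i)) := by
    refine (T2Space.isSeparatedMap F).eqOn_of_comp_eqOn hF.isLocallyInjective
      (ordConnected_uIcc.inter ordConnected_uIcc).isPreconnected
      (hγ₁.mono inter_subset_left) (hγ₂.mono inter_subset_right) (fun s hs => ?_)
      (a := F y i) ⟨right_mem_uIcc, left_mem_uIcc⟩ (hy₁.trans hy₂.symm)
    simp only [Function.comp_apply]
    rw [hFγ₁ s hs.1, hFγ₂ s hs.2, update_eq_update_of_dropCoord_eq hfxy]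
  classical
  let γ : ℝ → (Fin n → ℝ) := (uIcc (F x i) (F y i)).piecewise γ₁ γ₂
  have h1 : EqOn γ γ₁ (uIcc (F x i) (F y i)) := piecewise_eqOn _ _ _
  have h2 : EqOn γ γ₂ (uIcc (F y i) (F z i)) := by
    intro s hs
    by_cases hs' : s ∈ uIcc (F x i) (F y i)
    · rw [h1 hs', hagree ⟨hs', hs⟩]
    · exact piecewise_eq_of_notMem _ _ _ hs'
  have hsub : uIcc (F x i) (F z i) ⊆ uIcc (F x i) (F y i) ∪ uIcc (F y i) (F z i) :=
    uIcc_subset_uIcc_union_uIcc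
  refine ⟨hfxy.trans hfyz, γ, ?_, fun s hs => ?_, ?_, ?_⟩
  · exact ((hγ₁.congr h1).union_of_isClosed (hγ₂.congr h2) isClosed_Icc isClosed_Icc).mono hsub
  · rcases hsub hs with hs | hs
    · rw [h1 hs, hFγ₁ s hs]
    · rw [h2 hs, hFγ₂ s hs, update_eq_update_of_dropCoord_eq hfxy]
  · rw [h1 left_mem_uIcc, hx₁]
  · rw [h2 right_mem_uIcc, hz₂]

theorem SegmentLifts.eq_of_eq (h : SegmentLifts F i x y) (hi : F x i = F y i) : x = y := by
  obtain ⟨-, γ, -, -, hx, hy⟩ := h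
  rw [← hx, hi, hy]

/-- The lift of a segment stays within the class of its starting point. -/
theorem SegmentLifts.exists_path (h : SegmentLifts F i x y) :
    ∃ γ : ℝ → (Fin n → ℝ), ContinuousOn γ (uIcc (F x i) (F y i)) ∧
      (∀ s ∈ uIcc (F x i) (F y i),
        F (γ s) = Function.update (F x) i s ∧ SegmentLifts F i x (γ s)) ∧
      γ (F x i) = x ∧ γ (F y i) = y := by
  obtain ⟨-, γ, hγ, hFγ, hx, hy⟩ := h
  refine ⟨γ, hγ, fun s hs => ⟨hFγ s hs, (dropCoord_eq_of_eq_update (hFγ s hs)).symm, γ, ?_⟩, hx, hy⟩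
  have hs' : F (γ s) i = s := by rw [hFγ s hs, Function.update_self]
  have hsub : uIcc (F x i) s ⊆ uIcc (F x i) (F y i) := uIcc_subset_uIcc left_mem_uIcc hs
  rw [hs']
  exact ⟨hγ.mono hsub, fun t ht => hFγ t (hsub ht), hx, rfl⟩

theorem isPreconnected_setOf_segmentLifts : IsPreconnected {y | SegmentLifts F i x y} := by
  refine isPreconnected_of_forall x fun y hy => ?_
  obtain ⟨γ, hγ, hFγ, hx, hy⟩ := SegmentLifts.exists_path hy
  refine ⟨γ '' uIcc (F x i) (F y i), ?_, ⟨_, left_mem_uIcc, hx⟩, ⟨_, right_mem_uIcc, hy⟩,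
    isPreconnected_uIcc.image _ hγ⟩
  rintro _ ⟨s, hs, rfl⟩
  exact (hFγ s hs).2

theorem eventually_segmentLifts (hF : IsLocalHomeomorph F) (i : Fin n) (x : Fin n → ℝ) :
    ∀ᶠ y in 𝓝 x, dropCoord F i x = dropCoord F i y → SegmentLifts F i x y := by
  obtain ⟨e, hxe, rfl⟩ := hF x
  obtain ⟨r, hr, hball⟩ := Metric.isOpen_iff.1 e.open_target (e x) (e.map_source hxe)
  filter_upwards [e.open_source.mem_nhds hxe,
    (hF.continuous.tendsto x) (Metric.ball_mem_nhds (e x) hr)] with y hye hy hxy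
  have hmem : ∀ s ∈ uIcc (e x i) (e y i), Function.update (e x) i s ∈ e.target := by
    intro s hs
    refine hball ?_
    have h1 : |s - e x i| ≤ |e y i - e x i| := abs_sub_left_of_mem_uIcc hs
    have h2 : |e y i - e x i| < r := by
      rw [← Real.dist_eq]
      exact (dist_le_pi_dist (e y) (e x) i).trans_lt hy
    rw [Metric.mem_ball, update_eq_add_single, dist_self_add_left, norm_smul, Pi.norm_single]
    simpa using h1.trans_lt h2
  refine ⟨hxy, fun s => e.symm (Function.update (e x) i s), ?_, fun s hs => ?_, ?_, ?_⟩
  · exact e.continuousOn_symm.comp (by fun_prop) hmem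
  · exact e.right_inv (hmem s hs)
  · simp [e.left_inv hxe]
  · beta_reduce
    rw [← eq_update_of_dropCoord_eq hxy, e.left_inv hye]

/-- A connected subset of a fibre lies in a single class. -/
theorem segmentLifts_of_isPreconnected (hF : IsLocalHomeomorph F) {S : Set (Fin n → ℝ)}
    (hS : IsPreconnected S) (hfib : ∀ x ∈ S, ∀ y ∈ S, dropCoord F i x = dropCoord F i y)
    (hx : x ∈ S) (hy : y ∈ S) : SegmentLifts F i x y := by
  refine hS.induction₂ (SegmentLifts F i) (fun a ha => ?_) (fun _ _ _ _ _ _ h h' => h.trans hF h')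
    (fun _ _ _ _ h => h.symm) hx hy
  filter_upwards [mem_nhdsWithin_of_mem_nhds (eventually_segmentLifts hF i a),
    self_mem_nhdsWithin] with b hb hbS
  exact hb (hfib a ha b hbS)

theorem isClopen_setOf_segmentLifts (hF : IsLocalHomeomorph F) (x : Fin n → ℝ)
    (t : {j : Fin n // j ≠ i} → ℝ) :
    IsClopen {y : dropCoord F i ⁻¹' {t} | SegmentLifts F i x y} := by
  have hnear : ∀ y : dropCoord F i ⁻¹' {t}, ∀ᶠ z : dropCoord F i ⁻¹' {t} in 𝓝 y,
      SegmentLifts F i y z := by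
    intro y
    filter_upwards [continuous_subtype_val.continuousAt.eventually
      (eventually_segmentLifts hF i (y : Fin n → ℝ))] with z hz
    exact hz (y.2.trans z.2.symm)
  constructor
  · rw [← isOpen_compl_iff, isOpen_iff_mem_nhds]
    intro y hy
    filter_upwards [hnear y] with z hz hxz
    exact hy (SegmentLifts.trans hF hxz hz.symm)
  · rw [isOpen_iff_mem_nhds]
    intro y hy
    filter_upwards [hnear y] with z hz
    exact SegmentLifts.trans hF hy hz

end

theorem continuous_dropCoord {n : ℕ} {F : (Fin n → ℝ) → (Fin n → ℝ)} (hF : Continuous F)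
    (i : Fin n) : Continuous (dropCoord F i) :=
  continuous_pi fun j => (continuous_apply j.1).comp hF

/-- A local trivialization of `dropCoord F i` near `p` yields an open neighbourhood of `p` that is
a union of components of fibres, one for each fibre that it meets. -/
theorem exists_isOpen_fibrewise_connected {n : ℕ} {F : (Fin n → ℝ) → (Fin n → ℝ)}
    (hF : IsLocalHomeomorph F) {i : Fin n} {p : Fin n → ℝ}
    (hp : IsLocalFibrationAt (dropCoord F i) (dropCoord F i p)) :
    ∃ V : Set ({j : Fin n // j ≠ i} → ℝ), ∃ U : Set (Fin n → ℝ), IsOpen V ∧ IsOpen U ∧ p ∈ U ∧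
      U ⊆ dropCoord F i ⁻¹' V ∧
      (∀ K ⊆ V, IsClosed K → IsClosed (U ∩ dropCoord F i ⁻¹' K)) ∧
      (∀ x ∈ U, ∀ y ∈ U, dropCoord F i x = dropCoord F i y → SegmentLifts F i x y) ∧
      ∀ x ∈ U, ∀ y, SegmentLifts F i x y → y ∈ U := by
  have hf : Continuous (dropCoord F i) := continuous_dropCoord hF.continuous i
  set f := dropCoord F i
  obtain ⟨V, hV, h, hh⟩ := hp
  have hVV : f ⁻¹' interior V ⊆ f ⁻¹' V := preimage_mono interior_subset
  have hpV : p ∈ f ⁻¹' V := mem_preimage.2 (mem_of_mem_nhds hV)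
  let r : f ⁻¹' V → f ⁻¹' {f p} := fun x => (h.symm x).1
  have hr : Continuous r := continuous_fst.comp h.symm.continuous
  let q : f ⁻¹' {f p} := r ⟨p, hpV⟩
  let L : Set (f ⁻¹' {f p}) := {y | SegmentLifts F i q y}
  have hL : IsClopen L := isClopen_setOf_segmentLifts hF q (f p)
  have hLconn : IsPreconnected L := by
    rw [← Topology.IsInducing.subtypeVal.isPreconnected_image]
    convert isPreconnected_setOf_segmentLifts (F := F) (i := i) (x := q) using 1
    ext y
    constructor
    · rintro ⟨z, hz, rfl⟩
      exact hz
    · intro hy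
      exact ⟨⟨y, hy.1.symm.trans q.2⟩, hy, rfl⟩
  have hA : IsClopen (r ⁻¹' L) := hL.preimage hr
  obtain ⟨O, hO, hOA⟩ := isOpen_induced_iff.1 hA.isOpen
  obtain ⟨C, hC, hCA⟩ := isClosed_induced_iff.1 hA.isClosed
  have hOmem : ∀ x (hx : x ∈ f ⁻¹' V), x ∈ O ↔ r ⟨x, hx⟩ ∈ L := fun x hx =>
    Set.ext_iff.1 hOA ⟨x, hx⟩
  have hCmem : ∀ x (hx : x ∈ f ⁻¹' V), x ∈ C ↔ r ⟨x, hx⟩ ∈ L := fun x hx =>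
    Set.ext_iff.1 hCA ⟨x, hx⟩
  have hclosed : ∀ K ⊆ interior V, IsClosed K → IsClosed (O ∩ f ⁻¹' interior V ∩ f ⁻¹' K) := by
    intro K hK hKc
    have heq : O ∩ f ⁻¹' interior V ∩ f ⁻¹' K = C ∩ f ⁻¹' K := by
      ext x
      constructor
      · rintro ⟨⟨hxO, hxV⟩, hxK⟩
        exact ⟨(hCmem x (hVV hxV)).2 ((hOmem x _).1 hxO), hxK⟩
      · rintro ⟨hxC, hxK⟩
        exact ⟨⟨(hOmem x (hVV (hK hxK))).2 ((hCmem x _).1 hxC), hK hxK⟩, hxK⟩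
    rw [heq]
    exact hC.inter (hKc.preimage hf)
  have hopen : IsOpen (O ∩ f ⁻¹' interior V) := hO.inter (isOpen_interior.preimage hf)
  refine ⟨interior V, O ∩ f ⁻¹' interior V, isOpen_interior, hopen,
    ⟨(hOmem p hpV).2 (SegmentLifts.refl _), mem_interior_iff_mem_nhds.2 hV⟩,
    inter_subset_right, hclosed, ?_, ?_⟩
  · rintro x ⟨hxO, hxV⟩ y ⟨hyO, hyV⟩ hxy
    have hxV' : x ∈ f ⁻¹' V := hVV hxV
    have hyV' : y ∈ f ⁻¹' V := hVV hyV
    let σ : f ⁻¹' {f p} → (Fin n → ℝ) := fun l => (h (l, ⟨f x, hxV'⟩)).1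
    have hσ : Continuous σ := continuous_subtype_val.comp
      (h.continuous.comp (continuous_id.prodMk continuous_const))
    have hfσ : ∀ l, f (σ l) = f x := fun l => hh _
    have hrec : ∀ w (hw : w ∈ f ⁻¹' V), f w = f x → σ (r ⟨w, hw⟩) = w := by
      intro w hw hwx
      have h1 : (h.symm ⟨w, hw⟩).2 = ⟨f x, hxV'⟩ := by
        refine Subtype.ext ?_
        rw [← hh, h.apply_symm_apply]
        exact hwx
      have h2 : ((h.symm ⟨w, hw⟩).1, (⟨f x, hxV'⟩ : V)) = h.symm ⟨w, hw⟩ := by rw [← h1]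
      simp only [σ, r, h2, h.apply_symm_apply]
    refine segmentLifts_of_isPreconnected hF (hLconn.image σ hσ.continuousOn) ?_
      ⟨_, (hOmem x hxV').1 hxO, hrec x hxV' rfl⟩ ⟨_, (hOmem y hyV').1 hyO, hrec y hyV' hxy.symm⟩
    rintro _ ⟨a, -, rfl⟩ _ ⟨b, -, rfl⟩
    exact (hfσ a).trans (hfσ b).symm
  · intro x hx y hxy
    have hcl := hclosed {f x} (singleton_subset_iff.2 hx.2) isClosed_singleton
    have hcover : {y | SegmentLifts F i x y} ⊆ (O ∩ f ⁻¹' interior V) ∪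
        (O ∩ f ⁻¹' interior V ∩ f ⁻¹' {f x})ᶜ := by
      intro z _
      by_cases hz : z ∈ O ∩ f ⁻¹' interior V
      · exact Or.inl hz
      · exact Or.inr fun hz' => hz hz'.1
    have hdisj : {y | SegmentLifts F i x y} ∩ ((O ∩ f ⁻¹' interior V) ∩
        (O ∩ f ⁻¹' interior V ∩ f ⁻¹' {f x})ᶜ) = ∅ :=
      eq_empty_of_forall_notMem fun z hz => hz.2.2 ⟨hz.2.1, hz.1.1.symm⟩
    rcases isPreconnected_iff_subset_of_disjoint.1 isPreconnected_setOf_segmentLifts _ _ hopen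
      hcl.isOpen_compl hcover hdisj with hT | hT
    · exact hT hxy
    · exact absurd ⟨hx, rfl⟩ (hT (SegmentLifts.refl x))

theorem fderiv_prod_one_sub_apply_eq_zero {E : Type*} [NormedAddCommGroup E] [NormedSpace ℝ E]
    {v x : E} {ψ : ℕ → E → ℝ} (hψ : ∀ m, DifferentiableAt ℝ (ψ m) x)
    (hv : ∀ m, fderiv ℝ (ψ m) x v = 0) (m : ℕ) :
    fderiv ℝ (fun y => ∏ j ∈ Finset.range m, (1 - ψ j y)) x v = 0 := by
  suffices h : DifferentiableAt ℝ (fun y => ∏ j ∈ Finset.range m, (1 - ψ j y)) x ∧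
      fderiv ℝ (fun y => ∏ j ∈ Finset.range m, (1 - ψ j y)) x v = 0 from h.2
  induction m with
  | zero => simp
  | succ m ih =>
    simp only [Finset.prod_range_succ]
    have h2 : DifferentiableAt ℝ (fun y => 1 - ψ m y) x := (hψ m).const_sub 1
    refine ⟨ih.1.mul h2, ?_⟩
    rw [fderiv_fun_mul ih.1 h2, fderiv_const_sub]
    simp [ih.2, hv]

theorem sum_mul_prod_one_sub (ψ : ℕ → ℝ) (M : ℕ) :
    ∑ m ∈ Finset.range M, ψ m * ∏ j ∈ Finset.range m, (1 - ψ j) =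
      1 - ∏ j ∈ Finset.range M, (1 - ψ j) := by
  induction M with
  | zero => simp
  | succ M ih =>
    rw [Finset.sum_range_succ, ih, Finset.prod_range_succ]
    ring

/-- Local solutions of `ξ g = h` that come with first integrals of `ξ` as cutoff functions can be
glued to a global solution. -/
theorem exists_global_of_local_cutoff {E : Type*} [NormedAddCommGroup E] [NormedSpace ℝ E]
    [SecondCountableTopology E] (ξ : E → E) (h : E → ℝ)
    (hloc : ∀ p : E, ∃ ψ a : E → ℝ, ContDiff ℝ ∞ ψ ∧ ContDiff ℝ ∞ a ∧
      (∀ x, fderiv ℝ ψ x (ξ x) = 0) ∧ (∀ x, fderiv ℝ a x (ξ x) = ψ x * h x) ∧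
      ∀ᶠ x in 𝓝 p, ψ x = 1) :
    ∃ g : E → ℝ, ContDiff ℝ ∞ g ∧ ∀ x, fderiv ℝ g x (ξ x) = h x := by
  choose ψ' a' hψ' ha' hψξ' haξ' hone using hloc
  obtain ⟨S, hS, hcover⟩ := TopologicalSpace.countable_cover_nhds
    fun p => interior_mem_nhds.2 (hone p)
  have hSne : S.Nonempty := by
    have h0 : (0 : E) ∈ ⋃ x ∈ S, interior {y | ψ' x y = 1} := hcover ▸ mem_univ _
    obtain ⟨y, hy, -⟩ := mem_iUnion₂.1 h0
    exact ⟨y, hy⟩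
  obtain ⟨c, rfl⟩ := hS.exists_eq_range hSne
  let ψ : ℕ → E → ℝ := fun m => ψ' (c m)
  let P : ℕ → E → ℝ := fun m y => ∏ j ∈ Finset.range m, (1 - ψ j y)
  let b : ℕ → E → ℝ := fun m y => a' (c m) y * P m y
  have hψ : ∀ m, ContDiff ℝ ∞ (ψ m) := fun m => hψ' _
  have hP : ∀ m, ContDiff ℝ ∞ (P m) := fun m =>
    contDiff_prod fun j _ => contDiff_const.sub (hψ j)
  have hb : ∀ m, ContDiff ℝ ∞ (b m) := fun m => (ha' _).mul (hP m)
  have hbξ : ∀ m x, fderiv ℝ (b m) x (ξ x) = (ψ m x * P m x) * h x := by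
    intro m x
    have h0 : fderiv ℝ (P m) x (ξ x) = 0 := fderiv_prod_one_sub_apply_eq_zero
      (fun m => (hψ m).differentiable (by simp) x) (fun m => hψξ' _ x) m
    have h1 : fderiv ℝ (a' (c m)) x (ξ x) = ψ m x * h x := haξ' _ x
    rw [fderiv_fun_mul ((ha' _).differentiable (by simp) x) ((hP m).differentiable (by simp) x)]
    simp only [add_apply, smul_apply, smul_eq_mul, h0, h1]
    ring
  have hnear : ∀ x, ∃ m, ∀ᶠ y in 𝓝 x, ψ m y = 1 := by
    intro x
    have h0 : x ∈ ⋃ p ∈ range c, interior {y | ψ' p y = 1} := hcover ▸ mem_univ x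
    obtain ⟨p, ⟨m, rfl⟩, hx⟩ := mem_iUnion₂.1 h0
    exact ⟨m, mem_interior_iff_mem_nhds.1 hx⟩
  have hPzero : ∀ m M y, m < M → ψ m y = 1 → P M y = 0 := fun m M y hm hy =>
    Finset.prod_eq_zero (Finset.mem_range.2 hm) (by rw [hy, sub_self])
  have hsum : ∀ m y, ψ m y = 1 → ∑ᶠ k, b k y = ∑ k ∈ Finset.range (m + 1), b k y := by
    intro m y hy
    refine finsum_eq_sum_of_support_subset _ fun k hk => ?_
    rw [Finset.coe_range, mem_Iio]
    by_contra hlt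
    exact hk (by simp only [b, hPzero m k y (by omega) hy, mul_zero])
  have hgnear : ∀ x, ∃ m, ψ m x = 1 ∧
      (fun y => ∑ᶠ k, b k y) =ᶠ[𝓝 x] fun y => ∑ k ∈ Finset.range (m + 1), b k y := by
    intro x
    obtain ⟨m, hm⟩ := hnear x
    exact ⟨m, hm.self_of_nhds, hm.mono (hsum m)⟩
  refine ⟨fun y => ∑ᶠ k, b k y, contDiff_iff_contDiffAt.2 fun x => ?_, fun x => ?_⟩
  · obtain ⟨m, -, hm⟩ := hgnear x
    exact (ContDiff.sum fun k _ => hb k).contDiffAt.congr_of_eventuallyEq hm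
  · obtain ⟨m, hmx, hm⟩ := hgnear x
    rw [hm.fderiv_eq, fderiv_fun_sum fun k _ => (hb k).differentiable (by simp) x,
      sum_apply]
    simp only [hbξ]
    rw [← Finset.sum_mul, sum_mul_prod_one_sub (fun k => ψ k x)]
    have h0 : ∏ j ∈ Finset.range (m + 1), (1 - ψ j x) = 0 :=
      hPzero m (m + 1) x (Nat.lt_succ_self m) hmx
    rw [h0, sub_zero, one_mul]

theorem contDiff_dropCoord {n : ℕ} {F : (Fin n → ℝ) → (Fin n → ℝ)} (hF : ContDiff ℝ ∞ F)
    (i : Fin n) : ContDiff ℝ ∞ (dropCoord F i) :=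
  contDiff_pi.2 fun j => contDiff_pi.1 hF j.1

theorem fderiv_dropCoord_jacobianField {n : ℕ} {F : (Fin n → ℝ) → (Fin n → ℝ)}
    (hF : ContDiff ℝ ∞ F) {x : Fin n → ℝ} (hJ : jacobianDet F x ≠ 0) (i : Fin n) :
    fderiv ℝ (dropCoord F i) x (jacobianField F i x) = 0 := by
  have hd := (hF.differentiable (by simp) x).hasFDerivAt
  have hdrop : HasFDerivAt (dropCoord F i) (ContinuousLinearMap.pi fun j : {j : Fin n // j ≠ i} =>
      (ContinuousLinearMap.proj j.1).comp (fderiv ℝ F x)) x :=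
    hasFDerivAt_pi.2 fun j => hasFDerivAt_pi'.1 hd j.1
  rw [hdrop.fderiv]
  ext j
  have := congrFun (fderiv_jacobianField hJ i) j.1
  simpa [j.2] using this

/-- Solutions of `∂u/∂xᵢ = h / J(F)` in the coordinates given by `F`. -/
theorem exists_local_solution {n : ℕ} {F : (Fin n → ℝ) → (Fin n → ℝ)} (hF : ContDiff ℝ ∞ F)
    (hJ : ∀ x, jacobianDet F x ≠ 0) {i : Fin n} {h : (Fin n → ℝ) → ℝ} (hh : ContDiff ℝ ∞ h)
    {U : Set (Fin n → ℝ)} (hU : IsOpen U)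
    (hconn : ∀ x ∈ U, ∀ y ∈ U, dropCoord F i x = dropCoord F i y → SegmentLifts F i x y)
    (hsat : ∀ x ∈ U, ∀ y, SegmentLifts F i x y → y ∈ U) (s₀ : ℝ) :
    ∃ u : (Fin n → ℝ) → ℝ,
      ContDiffOn ℝ ∞ u (U ∩ {x | Function.update (F x) i s₀ ∈ F '' U}) ∧
      ∀ x ∈ U ∩ {x | Function.update (F x) i s₀ ∈ F '' U},
        fderiv ℝ u x (jacobianField F i x) = h x := by
  have hloc := isLocalHomeomorph_of_jacobianDet_ne_zero hF hJ
  have hinj : InjOn F U := fun x hx y hy hxy =>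
    (hconn x hx y hy (funext fun j => congrFun hxy j.1)).eq_of_eq (congrFun hxy i)
  obtain ⟨G, hG, hGF⟩ := exists_contDiffOn_leftInvOn hF hJ hU hinj
  have hW : IsOpen (F '' U) := hloc.isOpenMap U hU
  have hupd : Continuous fun w : Fin n → ℝ => Function.update w i s₀ := by fun_prop
  have hW' : IsOpen (F '' U ∩ {w | Function.update w i s₀ ∈ F '' U}) :=
    hW.inter (hW.preimage hupd)
  have hk : ContDiffOn ℝ ∞ (fun w => h (G w) / jacobianDet F (G w)) (F '' U) :=
    (hh.comp_contDiffOn hG).div ((contDiff_jacobianDet hF).comp_contDiffOn hG) fun _ _ => hJ _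
  obtain ⟨u, hu, hux⟩ := exists_coordinate_primitive i hW hW' hk s₀ (by
    rintro _ ⟨⟨x, hx, rfl⟩, y, hy, hxy⟩ s hs
    have hyi : F y i = s₀ := by rw [hxy, Function.update_self]
    obtain ⟨γ, -, hγ, -, -⟩ :=
      (hconn x hx y hy (dropCoord_eq_of_eq_update hxy).symm).exists_path
    rw [uIcc_comm, ← hyi] at hs
    exact ⟨γ s, hsat x hx _ (hγ s hs).2, (hγ s hs).1⟩)
  have hmem : ∀ x ∈ U ∩ {x | Function.update (F x) i s₀ ∈ F '' U},
      F x ∈ F '' U ∩ {w | Function.update w i s₀ ∈ F '' U} := fun x hx =>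
    ⟨mem_image_of_mem F hx.1, hx.2⟩
  refine ⟨u ∘ F, hu.comp hF.contDiffOn hmem, fun x hx => ?_⟩
  have hud : DifferentiableAt ℝ u (F x) :=
    (hu.contDiffAt (hW'.mem_nhds (hmem x hx))).differentiableAt (by simp)
  rw [fderiv_comp x hud (hF.differentiable (by simp) x), ContinuousLinearMap.comp_apply,
    fderiv_jacobianField (hJ x), map_smul, hux _ (hmem x hx), hGF hx.1, smul_eq_mul,
    mul_div_cancel₀ _ (hJ x)]

theorem exists_local_cutoff_solution {n : ℕ} {F : (Fin n → ℝ) → (Fin n → ℝ)}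
    (hF : ContDiff ℝ ∞ F) (hJ : ∀ x, jacobianDet F x ≠ 0) {i : Fin n} {p : Fin n → ℝ}
    (hp : IsLocalFibrationAt (dropCoord F i) (dropCoord F i p)) {h : (Fin n → ℝ) → ℝ}
    (hh : ContDiff ℝ ∞ h) :
    ∃ ψ a : (Fin n → ℝ) → ℝ, ContDiff ℝ ∞ ψ ∧ ContDiff ℝ ∞ a ∧
      (∀ x, fderiv ℝ ψ x (jacobianField F i x) = 0) ∧
      (∀ x, fderiv ℝ a x (jacobianField F i x) = ψ x * h x) ∧ ∀ᶠ x in 𝓝 p, ψ x = 1 := by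
  have hloc := isLocalHomeomorph_of_jacobianDet_ne_zero hF hJ
  have hf := contDiff_dropCoord hF i
  obtain ⟨V, U, hV, hU, hpU, hUV, hclosed, hconn, hsat⟩ := exists_isOpen_fibrewise_connected hloc hp
  obtain ⟨u, hu, hux⟩ := exists_local_solution hF hJ hh hU hconn hsat (F p i)
  set U' := U ∩ {x | Function.update (F x) i (F p i) ∈ F '' U}
  have hU' : IsOpen U' := by
    have hupd : Continuous fun x => Function.update (F x) i (F p i) :=
      hF.continuous.update i continuous_const
    exact hU.inter ((hloc.isOpenMap U hU).preimage hupd)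
  let ext : ({j : Fin n // j ≠ i} → ℝ) → (Fin n → ℝ) :=
    fun v j => if hj : j ≠ i then v ⟨j, hj⟩ else F p i
  have hext : Continuous ext := by
    refine continuous_pi fun j => ?_
    by_cases hj : j = i
    · simpa [ext, hj] using continuous_const
    · simpa [ext, hj] using continuous_apply _
  have hext_drop : ∀ x, ext (dropCoord F i x) = Function.update (F x) i (F p i) := by
    intro x
    ext j
    by_cases hj : j = i
    · subst hj
      simp [ext]
    · simp [ext, hj, dropCoord]
  have hO : IsOpen (V ∩ ext ⁻¹' (F '' U)) := hV.inter ((hloc.isOpenMap U hU).preimage hext)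
  have hpO : dropCoord F i p ∈ V ∩ ext ⁻¹' (F '' U) := by
    refine ⟨hUV hpU, ?_⟩
    rw [mem_preimage, hext_drop, Function.update_eq_self]
    exact mem_image_of_mem F hpU
  obtain ⟨r, hr, hball⟩ := Metric.nhds_basis_closedBall.mem_iff.1 (hO.mem_nhds hpO)
  let φ : ContDiffBump (dropCoord F i p) := ⟨r / 2, r, half_pos hr, half_lt_self hr⟩
  let C := U ∩ dropCoord F i ⁻¹' Metric.closedBall (dropCoord F i p) r
  have hC : IsClosed C := hclosed _ (hball.trans inter_subset_left) Metric.isClosed_closedBall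
  have hCU' : C ⊆ U' := fun x hx => ⟨hx.1, by
    have := (hball hx.2).2
    rwa [mem_preimage, hext_drop] at this⟩
  have hφ : ContDiff ℝ ∞ fun x => φ (dropCoord F i x) := φ.contDiff.comp hf
  let ψ : (Fin n → ℝ) → ℝ := U.indicator fun x => φ (dropCoord F i x)
  let a : (Fin n → ℝ) → ℝ := U.indicator fun x => φ (dropCoord F i x) * u x
  have hout : ∀ x, x ∉ C → x ∈ U → φ (dropCoord F i x) = 0 := fun x hxC hxU =>
    φ.zero_of_le_dist (le_of_not_ge fun hd => hxC ⟨hxU, hd⟩)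
  have hin : ∀ (b : (Fin n → ℝ) → ℝ), ∀ x ∈ U', U.indicator b =ᶠ[𝓝 x] b := fun b x hx =>
    Filter.mem_of_superset (hU.mem_nhds hx.1) fun y hy => indicator_of_mem hy b
  have hψout : ∀ x ∉ C, ψ =ᶠ[𝓝 x] fun _ => 0 := fun x hx => by
    filter_upwards [hC.isOpen_compl.mem_nhds hx] with y hy
    exact indicator_apply_eq_zero.2 fun hyU => hout y hy hyU
  have haout : ∀ x ∉ C, a =ᶠ[𝓝 x] fun _ => 0 := fun x hx => by
    filter_upwards [hC.isOpen_compl.mem_nhds hx] with y hy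
    exact indicator_apply_eq_zero.2 fun hyU => by rw [hout y hy hyU, zero_mul]
  have hux' : ∀ x ∈ U', ContDiffAt ℝ ∞ u x := fun x hx => hu.contDiffAt (hU'.mem_nhds hx)
  have hφξ : ∀ x, fderiv ℝ (fun x => φ (dropCoord F i x)) x (jacobianField F i x) = 0 := by
    intro x
    have hφd : ContDiff ℝ 1 φ := φ.contDiff
    have hc := fderiv_comp x (hφd.differentiable (by simp) (dropCoord F i x))
      (hf.differentiable (by simp) x)
    rw [Function.comp_def] at hc
    rw [hc, ContinuousLinearMap.comp_apply, fderiv_dropCoord_jacobianField hF (hJ x), map_zero]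
  refine ⟨ψ, a, contDiff_iff_contDiffAt.2 fun x => ?_, contDiff_iff_contDiffAt.2 fun x => ?_,
    fun x => ?_, fun x => ?_, ?_⟩
  · by_cases hx : x ∈ C
    · exact hφ.contDiffAt.congr_of_eventuallyEq (hin _ x (hCU' hx))
    · exact contDiffAt_const.congr_of_eventuallyEq (hψout x hx)
  · by_cases hx : x ∈ C
    · exact (hφ.contDiffAt.mul (hux' x (hCU' hx))).congr_of_eventuallyEq (hin _ x (hCU' hx))
    · exact contDiffAt_const.congr_of_eventuallyEq (haout x hx)
  · by_cases hx : x ∈ C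
    · rw [(hin _ x (hCU' hx)).fderiv_eq, hφξ]
    · rw [(hψout x hx).fderiv_eq, fderiv_fun_const]
      rfl
  · by_cases hx : x ∈ C
    · have hψx : ψ x = φ (dropCoord F i x) := (hin _ x (hCU' hx)).self_of_nhds
      rw [(hin _ x (hCU' hx)).fderiv_eq, hψx, fderiv_fun_mul (hφ.differentiable (by simp) x)
        ((hux' x (hCU' hx)).differentiableAt (by simp))]
      simp only [add_apply, smul_apply, hφξ, hux x (hCU' hx), smul_eq_mul, mul_zero, add_zero]
    · rw [(haout x hx).fderiv_eq, fderiv_fun_const, (hψout x hx).self_of_nhds, zero_mul]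
      rfl
  · filter_upwards [hU.mem_nhds hpU,
      hf.continuous.continuousAt.eventually φ.eventuallyEq_one] with x hxU hx
    exact (indicator_of_mem hxU _).trans hx

end JacobianOperators

end

theorem proposition3p1 (n : ℕ) (F : (Fin n → ℝ) → (Fin n → ℝ))
    (hF : ContDiff ℝ ∞ F)
    (hJ : ∀ x, JacobianOperators.jacobianDet F x ≠ 0)
    (i : Fin n)
    (hfib : JacobianOperators.IsLocalFibrationOnRange (JacobianOperators.dropCoord F i)) :
    JacobianOperators.jacobianOperator F i '' JacobianOperators.smoothFunctions n =
      JacobianOperators.smoothFunctions n := by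
  refine Set.Subset.antisymm ?_ fun h hh => ?_
  · rintro _ ⟨g, hg, rfl⟩
    exact JacobianOperators.contDiff_jacobianDet (JacobianOperators.contDiff_update hF i hg)
  · have hfibAt : ∀ p, JacobianOperators.IsLocalFibrationAt (JacobianOperators.dropCoord F i)
        (JacobianOperators.dropCoord F i p) := fun p => by
      by_contra hcon
      exact Set.eq_empty_iff_forall_notMem.1 hfib _ ⟨hcon, Set.mem_range_self p⟩
    obtain ⟨g, hg, hgh⟩ := JacobianOperators.exists_global_of_local_cutoff
      (JacobianOperators.jacobianField F i) h fun p =>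
        JacobianOperators.exists_local_cutoff_solution hF hJ (hfibAt p) hh
    refine ⟨g, hg, funext fun x => ?_⟩
    rw [JacobianOperators.jacobianOperator_eq_fderiv (hF.differentiable (by simp) x) (hJ x) i
      (ContDiff.differentiable hg (by simp) x), hgh]
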